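/- For $c\ge 1$ let $P_c(x)=\frac{1}{2^c c!}\left(\frac{d}{dx}\right)^c(x^2-1)^c$ be the $c$th Legendre polynomial, let $x_{1,c}<x_{2,c}<\dots<x_{c,c}$ be its $c$ zeros (all of which are simple and lie in $(-1,1)$), and put $$p_{k,c}=\frac{x_{k,c}+1}{2},\qquad w_{k,c}=\frac{2}{(1-x_{k,c}^2)^{3/2}\,P_c'(x_{k,c})^2}\quad(1\le k\le c),\qquad N_c=\sum_{k=1}^c w_{k,c}.$$ Let $\alpha>0$. Then, as $c\to\infty$, uniformly over all integers $k$ with $\alpha c<k<(1-\alpha)c$, $$p_{k,c}=\sin^2\left(\frac{\pi k}{2c}\right)+o(1),\qquad w_{k,c}=\frac{\pi}{c}+o\left(\frac1c\right);$$ that is, for every $\varepsilon>0$ there is a $c_0$ (depending only on $\alpha$ and $\varepsilon$) such that $\left|p_{k,c}-\sin^2\left(\frac{\pi k}{2c}\right)\right|\le\varepsilon$ and $\left|w_{k,c}-\frac{\pi}{c}\right|\le\frac{\varepsilon}{c}$ for all $c\ge c_0$ and all integers $k$ with $\alpha c<k<(1-\alpha)c$. Moreover $N_c\to\pi$ as $c\to\infty$,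 and $N_c<\pi$ for every $c\ge 1$. -/

import Mathlib

open Polynomial Filter Topology

noncomputable section

/-- The Legendre polynomial `P_c(x) = (1 / (2^c c!)) (d/dx)^c (x^2 - 1)^c`. -/
def legendreP (c : ℕ) : ℝ[X] :=
  C (1 / (2 ^ c * (c.factorial : ℝ))) * derivative^[c] ((X ^ 2 - 1) ^ c)

lemma legendre_base_monic (c : ℕ) : ((X ^ 2 - 1 : ℝ[X]) ^ c).Monic := by
  have h : (X ^ 2 - C (1 : ℝ)).Monic := monic_X_pow_sub_C 1 two_ne_zero
  rw [C_1] at h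
  exact h.pow c

lemma legendre_base_natDegree (c : ℕ) : ((X ^ 2 - 1 : ℝ[X]) ^ c).natDegree = 2 * c := by
  have h : (X ^ 2 - C (1 : ℝ)).natDegree = 2 := natDegree_X_pow_sub_C
  rw [C_1] at h
  rw [natDegree_pow, h, mul_comm]

lemma legendre_iterate_ne_zero (c j : ℕ) (hj : j ≤ c) :
    derivative^[j] ((X ^ 2 - 1 : ℝ[X]) ^ c) ≠ 0 := by
  intro h
  have h1 := congrArg (fun p : ℝ[X] => p.coeff (2 * c - j)) h
  have h2 : ((X ^ 2 - 1 : ℝ[X]) ^ c).coeff (2 * c) = 1 := by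
    have := (legendre_base_monic c).coeff_natDegree
    rwa [legendre_base_natDegree] at this
  simp only [coeff_iterate_derivative, coeff_zero, Nat.sub_add_cancel (show j ≤ 2 * c by omega),
    h2, nsmul_eq_mul, mul_one, Nat.cast_eq_zero, Nat.descFactorial_eq_zero_iff_lt] at h1
  omega

lemma legendre_iterate_root (c j : ℕ) (hj : j < c) (a : ℝ) (ha : a ^ 2 = 1) :
    a ∈ (derivative^[j] ((X ^ 2 - 1 : ℝ[X]) ^ c)).roots.toFinset := by
  rw [Multiset.mem_toFinset, mem_roots (legendre_iterate_ne_zero c j hj.le), IsRoot.def]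
  obtain ⟨q, hq⟩ := pow_sub_dvd_iterate_derivative_of_pow_dvd (p := (X ^ 2 - 1 : ℝ[X]) ^ c)
    (q := X ^ 2 - 1) j dvd_rfl
  rw [hq]
  simp [ha, Nat.sub_ne_zero_of_lt hj]

lemma legendre_iterate_card (c j : ℕ) (hj : j < c) :
    j + 2 ≤ (derivative^[j] ((X ^ 2 - 1 : ℝ[X]) ^ c)).roots.toFinset.card := by
  induction j with
  | zero =>
    rw [zero_add]
    refine (Finset.card_pair (show (-1 : ℝ) ≠ 1 by norm_num)).symm.le.trans ?_
    apply Finset.card_le_card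
    intro a ha
    apply legendre_iterate_root c 0 hj
    rcases Finset.mem_insert.1 ha with h | h
    · simp [h]
    · simp [Finset.mem_singleton.1 h]
  | succ j ih =>
    have h0 := ih (by omega)
    have h1 := card_roots_toFinset_le_card_roots_derivative_sdiff_roots_succ
      (derivative^[j] ((X ^ 2 - 1 : ℝ[X]) ^ c))
    rw [← Function.iterate_succ_apply' (⇑derivative)] at h1
    set A := (derivative^[j] ((X ^ 2 - 1 : ℝ[X]) ^ c)).roots.toFinset with hA
    set B := (derivative^[j + 1] ((X ^ 2 - 1 : ℝ[X]) ^ c)).roots.toFinset with hB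
    have h2 : 2 ≤ (B ∩ A).card := by
      rw [← Finset.card_pair (show (-1 : ℝ) ≠ 1 by norm_num)]
      apply Finset.card_le_card
      intro a ha
      have ha' : a ^ 2 = 1 := by
        rcases Finset.mem_insert.1 ha with h | h
        · simp [h]
        · simp [Finset.mem_singleton.1 h]
      exact Finset.mem_inter.2 ⟨legendre_iterate_root c (j + 1) hj a ha',
        legendre_iterate_root c j (by omega) a ha'⟩
    have h3 := Finset.card_sdiff_add_card_inter B A
    omega

/-- The Legendre polynomial `P_c` has exactly `c` distinct real zeros. -/
theorem legendreP_card_roots (c : ℕ) : (legendreP c).roots.toFinset.card = c := by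
  have hC : (1 / (2 ^ c * (c.factorial : ℝ))) ≠ 0 := by positivity
  rw [legendreP, roots_C_mul _ hC]
  apply le_antisymm
  · refine (Multiset.toFinset_card_le _).trans ((card_roots' _).trans ?_)
    refine (natDegree_iterate_derivative _ _).trans ?_
    rw [legendre_base_natDegree]
    omega
  · rcases c with _ | c
    · simp
    · have h0 := legendre_iterate_card (c + 1) c (by omega)
      have h1 := card_roots_toFinset_le_card_roots_derivative_sdiff_roots_succ
        (derivative^[c] ((X ^ 2 - 1 : ℝ[X]) ^ (c + 1)))
      rw [← Function.iterate_succ_apply' (⇑derivative)] at h1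
      have h2 := Finset.card_le_card (Finset.sdiff_subset
        (s := (derivative^[c + 1] ((X ^ 2 - 1 : ℝ[X]) ^ (c + 1))).roots.toFinset)
        (t := (derivative^[c] ((X ^ 2 - 1 : ℝ[X]) ^ (c + 1))).roots.toFinset))
      simp only [Nat.succ_eq_add_one] at h1
      omega

/-- All zeros of `P_c` lie in the open interval `(-1, 1)`. -/
theorem legendreP_root_mem_Ioo (c : ℕ) (x : ℝ) (hx : (legendreP c).eval x = 0) :
    x ∈ Set.Ioo (-1 : ℝ) 1 := by
  have hC : (1 / (2 ^ c * (c.factorial : ℝ))) ≠ 0 := by positivity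
  rw [legendreP, eval_mul, eval_C, mul_eq_zero, or_iff_right hC,
    show (X ^ 2 - 1 : ℝ[X]) = (X - C 1) * (X + C 1) by rw [C_1]; ring, mul_pow,
    iterate_derivative_mul, eval_finsetSum] at hx
  simp only [iterate_derivative_X_sub_pow, iterate_derivative_X_add_pow, eval_mul,
    eval_pow, eval_sub, eval_add, eval_X, eval_C, nsmul_eq_mul, eval_natCast] at hx
  by_contra hn
  rw [Set.mem_Ioo, not_and_or, not_lt, not_lt] at hn
  rcases hn with h | h
  · have h1 : 0 < ∑ k ∈ Finset.range c.succ, ((c.choose k : ℝ) *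
        ((c.descFactorial (c - k) : ℝ) * (1 - x) ^ (c - (c - k)) *
          ((c.descFactorial k : ℝ) * (-1 - x) ^ (c - k)))) := by
      have a1 : 0 < 1 - x := by linarith
      have a2 : 0 ≤ -1 - x := by linarith
      apply Finset.sum_pos'
      · intro k _
        positivity
      · refine ⟨c, Finset.self_mem_range_succ c, ?_⟩
        have := Nat.factorial_pos c
        simp only [Nat.choose_self, Nat.sub_self, Nat.descFactorial_zero, Nat.sub_zero,
          Nat.descFactorial_self, pow_zero]
        positivity
    have h2 : ∑ k ∈ Finset.range c.succ, ((c.choose k : ℝ) *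
        ((c.descFactorial (c - k) : ℝ) * (1 - x) ^ (c - (c - k)) *
          ((c.descFactorial k : ℝ) * (-1 - x) ^ (c - k)))) = (-1) ^ c * 0 := by
      rw [← hx, Finset.mul_sum]
      refine Finset.sum_congr rfl fun k hk => ?_
      have hk' : c - (c - k) + (c - k) = c := by omega
      rw [show 1 - x = (-1) * (x - 1) by ring, show -1 - x = (-1) * (x + 1) by ring, mul_pow,
        mul_pow, ← congrArg (fun n : ℕ => (-1 : ℝ) ^ n) hk']
      rw [pow_add]
      ring
    rw [h2, mul_zero] at h1
    exact lt_irrefl _ h1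
  · have a1 : 0 < x + 1 := by linarith
    have a2 : 0 ≤ x - 1 := by linarith
    refine absurd hx (ne_of_gt (Finset.sum_pos' (fun k _ => by positivity) ⟨0, by simp, ?_⟩))
    have := Nat.factorial_pos c
    simp only [Nat.choose_zero_right, Nat.sub_self, Nat.descFactorial_zero, Nat.sub_zero,
      Nat.descFactorial_self, pow_zero]
    positivity

/-- The zeros `x_{1,c} < x_{2,c} < ... < x_{c,c}` of `P_c` in increasing order.
The index `i : Fin c` stands for `k = i + 1`, so that `legendreNode c i` is `x_{i+1,c}`. -/
def legendreNode (c : ℕ) (i : Fin c) : ℝ :=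
  (legendreP c).roots.toFinset.orderEmbOfFin (legendreP_card_roots c) i

/-- The point `p_{k,c} = (x_{k,c} + 1) / 2`, with `k = i + 1`. -/
def glPoint (c : ℕ) (i : Fin c) : ℝ := (legendreNode c i + 1) / 2

/-- The weight `w_{k,c} = 2 / ((1 - x_{k,c}^2)^{3/2} P_c'(x_{k,c})^2)`, with `k = i + 1`. -/
def glWeight (c : ℕ) (i : Fin c) : ℝ :=
  2 / ((1 - legendreNode c i ^ 2) ^ (3 / 2 : ℝ) *
    ((derivative (legendreP c)).eval (legendreNode c i)) ^ 2)

/-- The normalizing constant `N_c = ∑_{k=1}^c w_{k,c}`. -/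
def glNorm (c : ℕ) : ℝ := ∑ i : Fin c, glWeight c i

end

/-! With x = -cos t, the function u(t) = √(sin t) P_c(-cos t) satisfies u'' + φu = 0, where φ = (c +
1/2)² + 1/(4 sin² t). At a zero of u the Sonin function S = u'² + φu² equals sin³ t · P_c'(x)², so
the weight at that node is exactly 2/S (`two_div_legendreSonin_of_zero`).

Since S' = φ'u² and (S/φ)' = -φ'u'²/φ², while φ is smallest at π/2, S is minimal and S/φ maximal at
π/2. The value S(π/2) = E is explicit in central binomial coefficients, and Wallis' product gives 2c
< πE ≤ 2c + 3. The minimum yields w < π/c for every node (`glWeight_lt`), hence N_c < π. The maximum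
yields a matching lower bound wherever φ(t)/φ(π/2) is close to 1 (`le_glWeight`).

Sturm comparison with sin((c + 1/2)t) locates the angle of each node to within O(1/c)
(`exists_legendreNode_eq_neg_cos`). This gives the asymptotics of the points and controls φ at the
nodes; the error terms in the weights are summable, so N_c → π. -/

/-! ### The Legendre differential equation -/

/-- Repeated differentiation of (x² - 1)f' = 2cxf with f = (x² - 1)^c. The case j = c is Legendre's
equation up to a scalar. -/
theorem legendre_iterate_recurrence (c j : ℕ) :
    (X ^ 2 - 1) * derivative^[j + 2] ((X ^ 2 - 1 : ℝ[X]) ^ c) =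
      C (2 * ((c : ℝ) - j - 1)) * X * derivative^[j + 1] ((X ^ 2 - 1 : ℝ[X]) ^ c) +
        C (((j : ℝ) + 1) * (2 * c - j)) * derivative^[j] ((X ^ 2 - 1 : ℝ[X]) ^ c) := by
  induction j with
  | zero =>
    have h : (X ^ 2 - 1) * derivative ((X ^ 2 - 1 : ℝ[X]) ^ c) =
        C (2 * (c : ℝ)) * X * (X ^ 2 - 1) ^ c := by
      rcases c with _ | c
      · simp
      · rw [derivative_pow_succ]
        simp only [map_sub, derivative_X_pow, derivative_one, map_mul, map_add, map_natCast,
          map_ofNat, map_one]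
        push_cast
        ring
    have h' := congrArg derivative h
    simp only [derivative_mul, derivative_sub, derivative_X_pow, derivative_one, derivative_C,
      derivative_X] at h'
    simp only [Function.iterate_succ, Function.iterate_zero, Function.comp_apply, id_eq]
    simp only [map_sub, map_mul, map_add, map_natCast, map_ofNat, map_one] at h' ⊢
    push_cast at h' ⊢
    linear_combination h'
  | succ j ih =>
    have h' := congrArg derivative ih
    simp only [derivative_mul, derivative_sub, derivative_add, derivative_X_pow, derivative_one,
      derivative_C, derivative_X, ← Function.iterate_succ_apply' (⇑derivative)] at h'
    simp only [map_sub, map_mul, map_add, map_natCast, map_ofNat, map_one] at h' ⊢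
    push_cast at h' ⊢
    linear_combination h'

/-- The Legendre differential equation. -/
theorem legendreP_ode (c : ℕ) (x : ℝ) :
    (1 - x ^ 2) * (derivative (derivative (legendreP c))).eval x =
      2 * x * (derivative (legendreP c)).eval x - c * (c + 1) * (legendreP c).eval x := by
  have h := congrArg (eval x) (legendre_iterate_recurrence c c)
  simp only [Function.iterate_succ_apply', eval_mul, eval_add, eval_sub, eval_pow, eval_X,
    eval_one, eval_C] at h
  simp only [legendreP, derivative_C_mul, eval_mul, eval_C]
  linear_combination (-(1 / (2 ^ c * (c.factorial : ℝ)))) * h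

/-! ### Values at the equator and Wallis bounds -/

theorem coeff_X_sq_sub_one_pow (c k : ℕ) :
    ((X ^ 2 - 1 : ℝ[X]) ^ c).coeff k =
      if 2 ∣ k then (-1) ^ (c - k / 2) * (c.choose (k / 2) : ℝ) else 0 := by
  have h : (X ^ 2 - 1 : ℝ[X]) ^ c = expand ℝ 2 ((X + C (-1)) ^ c) := by simp [sub_eq_add_neg]
  rw [h, coeff_expand two_pos, coeff_X_add_C_pow]

theorem legendreP_eval_zero (c : ℕ) :
    (legendreP c).eval 0 = ((X ^ 2 - 1 : ℝ[X]) ^ c).coeff c / 2 ^ c := by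
  rw [← coeff_zero_eq_eval_zero, legendreP, coeff_C_mul, coeff_iterate_derivative]
  have : (c.factorial : ℝ) ≠ 0 := by positivity
  simp only [zero_add, Nat.descFactorial_self, nsmul_eq_mul]
  field_simp

theorem derivative_legendreP_eval_zero (c : ℕ) :
    (derivative (legendreP c)).eval 0 =
      (c + 1) * ((X ^ 2 - 1 : ℝ[X]) ^ c).coeff (c + 1) / 2 ^ c := by
  rw [← coeff_zero_eq_eval_zero, coeff_derivative, legendreP, coeff_C_mul,
    coeff_iterate_derivative]
  have : (c.factorial : ℝ) ≠ 0 := by positivity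
  have h : (0 + 1 + c).descFactorial c = (c + 1) * c.factorial := by
    rw [← Nat.factorial_succ, zero_add, add_comm, ← Nat.factorial_mul_descFactorial (n := c + 1)
      (k := c) (by omega)]
    simp
  rw [h, zero_add, add_comm 1 c, nsmul_eq_mul]
  push_cast
  field_simp
  ring

theorem wallis_eq_centralBinom (m : ℕ) :
    Real.Wallis.W m * (((m.centralBinom : ℝ) / 4 ^ m) ^ 2 * (2 * m + 1)) = 1 := by
  have h := Nat.centralBinom_eq_two_mul_choose m
  have h2 := Nat.choose_mul_factorial_mul_factorial (show m ≤ 2 * m by omega)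
  rw [← h, show 2 * m - m = m by omega] at h2
  have h3 : ((2 * m).factorial : ℝ) = m.centralBinom * m.factorial * m.factorial := by
    exact_mod_cast h2.symm
  have h4 : (m.centralBinom : ℝ) ≠ 0 := by exact_mod_cast m.centralBinom_ne_zero
  have h5 : (m.factorial : ℝ) ≠ 0 := by positivity
  have h6 : (2 : ℝ) ^ (4 * m) = (4 ^ m) ^ 2 := by
    rw [← pow_mul, show (4 : ℝ) = 2 ^ 2 by norm_num, ← pow_mul]
    congr 1
    ring
  rw [Real.Wallis.W_eq_factorial_ratio, h3, h6]
  field_simp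

theorem le_centralBinom_div_sq (m : ℕ) :
    2 ≤ ((m.centralBinom : ℝ) / 4 ^ m) ^ 2 * (2 * m + 1) * Real.pi := by
  have h := wallis_eq_centralBinom m
  have h1 := Real.Wallis.W_le m
  have h2 : 0 ≤ ((m.centralBinom : ℝ) / 4 ^ m) ^ 2 * (2 * m + 1) := by positivity
  nlinarith [mul_le_mul_of_nonneg_right h1 h2]

theorem centralBinom_div_sq_le (m : ℕ) :
    ((m.centralBinom : ℝ) / 4 ^ m) ^ 2 * (2 * m + 1) ^ 2 * Real.pi ≤ 4 * (m + 1) := by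
  have h := wallis_eq_centralBinom m
  have h1 := Real.Wallis.le_W m
  have h2 : 0 ≤ ((m.centralBinom : ℝ) / 4 ^ m) ^ 2 * (2 * m + 1) := by positivity
  have h3 := mul_le_mul_of_nonneg_right h1 h2
  rw [h, div_mul_eq_mul_div, div_mul_eq_mul_div, div_le_one (by positivity)] at h3
  linarith

/-- The value at the equator of the Sonin function of `√(sin θ) P_c(-cos θ)`. -/
noncomputable def legendreEnergy (c : ℕ) : ℝ :=
  (derivative (legendreP c)).eval 0 ^ 2 +
    (((c : ℝ) + 1 / 2) ^ 2 + 1 / 4) * (legendreP c).eval 0 ^ 2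

theorem legendreEnergy_even (m : ℕ) :
    legendreEnergy (2 * m) =
      (4 * (m : ℝ) ^ 2 + 2 * m + 1 / 2) * ((m.centralBinom : ℝ) / 4 ^ m) ^ 2 := by
  have h : (2 : ℝ) ^ (2 * m) = 4 ^ m := by rw [pow_mul]; norm_num
  rw [legendreEnergy, legendreP_eval_zero, derivative_legendreP_eval_zero,
    coeff_X_sq_sub_one_pow, coeff_X_sq_sub_one_pow, if_neg (by omega), if_pos (by omega),
    Nat.mul_div_cancel_left _ two_pos, ← Nat.centralBinom_eq_two_mul_choose, h]
  simp only [div_pow, mul_pow, ← pow_mul, mul_comm _ 2, pow_mul (-1 : ℝ) 2, neg_one_sq, one_pow]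
  push_cast
  ring

theorem legendreEnergy_odd (m : ℕ) :
    legendreEnergy (2 * m + 1) =
      4 * ((m : ℝ) + 1) ^ 2 * (((m + 1).centralBinom : ℝ) / 4 ^ (m + 1)) ^ 2 := by
  have h : (2 : ℝ) ^ (2 * m + 1) = 4 ^ (m + 1) / 2 := by
    rw [pow_succ, pow_mul, pow_succ]; norm_num; ring
  have h1 : ((m + 1).centralBinom : ℝ) = 2 * ((2 * m + 1).choose (m + 1) : ℝ) := by
    have : (m + 1).centralBinom = 2 * (2 * m + 1).choose (m + 1) := by
      rw [Nat.centralBinom_eq_two_mul_choose, show 2 * (m + 1) = 2 * m + 1 + 1 by ring,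
        Nat.choose_succ_succ, ← Nat.choose_symm_half]
      ring
    exact_mod_cast this
  rw [legendreEnergy, legendreP_eval_zero, derivative_legendreP_eval_zero,
    coeff_X_sq_sub_one_pow, coeff_X_sq_sub_one_pow, if_pos (by omega), if_neg (by omega),
    show (2 * m + 1 + 1) / 2 = m + 1 by omega, h, h1]
  simp only [div_pow, mul_pow, ← pow_mul, mul_comm _ 2, pow_mul (-1 : ℝ) 2, neg_one_sq, one_pow]
  push_cast
  ring

/-- Strictness comes from the algebra, not from Wallis: the quadratic factor exceeds 2m(2m + 1) by
1/2 for even c, and (2m + 1)(2m + 3) by 1 for odd c. This is what makes N_c < π strict. -/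
theorem lt_legendreEnergy (c : ℕ) : 2 * c < legendreEnergy c * Real.pi := by
  obtain ⟨m, rfl | rfl⟩ := c.even_or_odd'
  · have h := le_centralBinom_div_sq m
    have h0 : (0 : ℝ) < ((m.centralBinom : ℝ) / 4 ^ m) ^ 2 * Real.pi := by
      have := m.centralBinom_pos
      positivity
    rw [legendreEnergy_even]
    push_cast
    nlinarith [mul_le_mul_of_nonneg_left h (Nat.cast_nonneg (α := ℝ) m)]
  · have h := le_centralBinom_div_sq (m + 1)
    have h0 : (0 : ℝ) < (((m + 1).centralBinom : ℝ) / 4 ^ (m + 1)) ^ 2 * Real.pi := by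
      have := (m + 1).centralBinom_pos
      positivity
    rw [legendreEnergy_odd]
    push_cast at h ⊢
    set b := (((m + 1).centralBinom : ℝ) / 4 ^ (m + 1)) ^ 2
    have hm : (0 : ℝ) ≤ 2 * m + 1 := by positivity
    nlinarith [mul_le_mul_of_nonneg_left h hm]

theorem legendreEnergy_le (c : ℕ) : legendreEnergy c * Real.pi ≤ 2 * c + 3 := by
  obtain ⟨m, rfl | rfl⟩ := c.even_or_odd'
  · have h := centralBinom_div_sq_le m
    have h0 : (0 : ℝ) ≤ ((m.centralBinom : ℝ) / 4 ^ m) ^ 2 * Real.pi := by positivity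
    rw [legendreEnergy_even]
    have h1 : (0 : ℝ) < (2 * m + 1) ^ 2 := by positivity
    refine le_of_mul_le_mul_left ?_ h1
    have h2 : (0 : ℝ) ≤ 4 * (m : ℝ) ^ 2 + 2 * m + 1 / 2 := by positivity
    have h3 : (0 : ℝ) ≤ m := by positivity
    push_cast
    nlinarith [mul_le_mul_of_nonneg_left h h2]
  · have h := centralBinom_div_sq_le (m + 1)
    have h0 : (0 : ℝ) ≤ (((m + 1).centralBinom : ℝ) / 4 ^ (m + 1)) ^ 2 * Real.pi := by positivity
    have h1 : (0 : ℝ) < (2 * m + 3) ^ 2 := by positivity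
    refine le_of_mul_le_mul_left ?_ h1
    have h2 : (0 : ℝ) ≤ 4 * ((m : ℝ) + 1) ^ 2 := by positivity
    have h3 : (0 : ℝ) ≤ m := by positivity
    rw [legendreEnergy_odd]
    push_cast at h ⊢
    nlinarith [mul_le_mul_of_nonneg_left h h2]

/-! ### The Sonin function in the angular variable -/

theorem hasDerivAt_eval_neg_cos (p : ℝ[X]) (t : ℝ) :
    HasDerivAt (fun t => p.eval (-Real.cos t))
      ((derivative p).eval (-Real.cos t) * Real.sin t) t := by
  have h : HasDerivAt (fun t => -Real.cos t) (Real.sin t) t :=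
    (Real.hasDerivAt_cos t).neg.congr_deriv (neg_neg _)
  exact (p.hasDerivAt (-Real.cos t)).comp t h

/-- `P_c(-cos t)` as a function of the angle `t`. -/
noncomputable def angularLegendre (c : ℕ) (t : ℝ) : ℝ := (legendreP c).eval (-Real.cos t)

/-- The derivative of `angularLegendre`. -/
noncomputable def angularLegendreDeriv (c : ℕ) (t : ℝ) : ℝ :=
  (derivative (legendreP c)).eval (-Real.cos t) * Real.sin t

theorem hasDerivAt_angularLegendre (c : ℕ) (t : ℝ) :
    HasDerivAt (angularLegendre c) (angularLegendreDeriv c t) t :=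
  hasDerivAt_eval_neg_cos _ t

theorem hasDerivAt_angularLegendreDeriv (c : ℕ) (t : ℝ) (ht : 0 < Real.sin t) :
    HasDerivAt (angularLegendreDeriv c)
      (-(Real.cos t / Real.sin t) * angularLegendreDeriv c t -
        c * (c + 1) * angularLegendre c t) t := by
  refine ((hasDerivAt_eval_neg_cos (derivative (legendreP c)) t).mul
    (Real.hasDerivAt_sin t)).congr_deriv ?_
  have h := legendreP_ode c (-Real.cos t)
  have h1 : 1 - (-Real.cos t) ^ 2 = Real.sin t ^ 2 := by rw [Real.sin_sq]; ring
  rw [h1] at h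
  simp only [angularLegendre, angularLegendreDeriv]
  field_simp
  linear_combination h

/-- The potential in the normal form `u'' + φ u = 0` of the Legendre equation. -/
noncomputable def legendrePotential (c : ℕ) (t : ℝ) : ℝ :=
  ((c : ℝ) + 1 / 2) ^ 2 + 1 / (4 * Real.sin t ^ 2)

/-- The Sonin function `u'² + φ u²` of `u = √(sin t) P_c(-cos t)`. -/
noncomputable def legendreSonin (c : ℕ) (t : ℝ) : ℝ :=
  Real.sin t * (angularLegendreDeriv c t + Real.cos t / (2 * Real.sin t) * angularLegendre c t) ^ 2
    + legendrePotential c t * (Real.sin t * angularLegendre c t ^ 2)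

theorem hasDerivAt_legendrePotential (c : ℕ) (t : ℝ) (ht : 0 < Real.sin t) :
    HasDerivAt (legendrePotential c) (-Real.cos t / (2 * Real.sin t ^ 3)) t := by
  have h := ((((Real.hasDerivAt_sin t).pow 2).const_mul 4).inv (c := fun t => 4 * Real.sin t ^ 2)
    (by positivity)).const_add (((c : ℝ) + 1 / 2) ^ 2)
  have h' : legendrePotential c = fun t => ((c : ℝ) + 1 / 2) ^ 2 + (4 * Real.sin t ^ 2)⁻¹ := by
    ext t; simp [legendrePotential]
  rw [h']
  refine h.congr_deriv ?_
  field_simp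
  ring

theorem legendrePotential_pos (c : ℕ) (t : ℝ) : 0 < legendrePotential c t := by
  unfold legendrePotential; positivity

theorem hasDerivAt_legendreSonin (c : ℕ) (t : ℝ) (ht : 0 < Real.sin t) :
    HasDerivAt (legendreSonin c)
      (-Real.cos t / (2 * Real.sin t ^ 3) * (Real.sin t * angularLegendre c t ^ 2)) t := by
  have hy := hasDerivAt_angularLegendre c t
  have hd := hasDerivAt_angularLegendreDeriv c t ht
  have hs := Real.hasDerivAt_sin t
  have hc := Real.hasDerivAt_cos t
  have h := (hs.mul ((hd.add ((hc.div (hs.const_mul 2) (by positivity)).mul hy)).pow 2)).add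
    ((hasDerivAt_legendrePotential c t ht).mul (hs.mul (hy.pow 2)))
  refine h.congr_deriv ?_
  have hcs : Real.cos t ^ 2 = 1 - Real.sin t ^ 2 := Real.cos_sq' t
  simp only [Pi.pow_apply, Pi.mul_apply, Pi.add_apply, Pi.div_apply, legendrePotential]
  generalize angularLegendre c t = y
  generalize angularLegendreDeriv c t = d
  generalize Real.cos t = a at *
  generalize Real.sin t = s at *
  have hs0 : s ≠ 0 := ht.ne'
  norm_num only [pow_one, Nat.cast_ofNat]
  field_simp
  linear_combination (-(4 * a * y ^ 2 + 8 * d * s * y)) * hcs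

/-- Shared monotonicity argument, applied to S and to -S/φ, whose derivatives both have the sign of
-cos or vanish. -/
theorem le_of_deriv_sign {f f' : ℝ → ℝ} {t : ℝ} (ht0 : 0 < t) (ht1 : t < Real.pi)
    (hf : ∀ x, 0 < Real.sin x → HasDerivAt f (f' x) x)
    (h0 : ∀ x, 0 < Real.sin x → 0 ≤ Real.cos x → f' x ≤ 0)
    (h1 : ∀ x, 0 < Real.sin x → Real.cos x ≤ 0 → 0 ≤ f' x) : f (Real.pi / 2) ≤ f t := by
  have hpi := Real.pi_pos
  rcases le_total t (Real.pi / 2) with h | h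
  · have hsin : ∀ x ∈ Set.Icc t (Real.pi / 2), 0 < Real.sin x := fun x hx =>
      Real.sin_pos_of_pos_of_lt_pi (by linarith [hx.1]) (by linarith [hx.2])
    refine antitoneOn_of_deriv_nonpos (convex_Icc t (Real.pi / 2))
      (fun x hx => (hf x (hsin x hx)).continuousAt.continuousWithinAt)
      (fun x hx => (hf x (hsin x (interior_subset hx))).differentiableAt.differentiableWithinAt)
      (fun x hx => ?_) (Set.left_mem_Icc.2 h) (Set.right_mem_Icc.2 h) h
    have hx' := interior_subset hx
    rw [(hf x (hsin x hx')).deriv]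
    exact h0 x (hsin x hx') (Real.cos_nonneg_of_mem_Icc ⟨by linarith [hx'.1], hx'.2⟩)
  · have hsin : ∀ x ∈ Set.Icc (Real.pi / 2) t, 0 < Real.sin x := fun x hx =>
      Real.sin_pos_of_pos_of_lt_pi (by linarith [hx.1]) (by linarith [hx.2])
    refine monotoneOn_of_deriv_nonneg (convex_Icc (Real.pi / 2) t)
      (fun x hx => (hf x (hsin x hx)).continuousAt.continuousWithinAt)
      (fun x hx => (hf x (hsin x (interior_subset hx))).differentiableAt.differentiableWithinAt)
      (fun x hx => ?_) (Set.left_mem_Icc.2 h) (Set.right_mem_Icc.2 h) h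
    have hx' := interior_subset hx
    rw [(hf x (hsin x hx')).deriv]
    exact h1 x (hsin x hx') (Real.cos_nonpos_of_pi_div_two_le_of_le hx'.1 (by linarith [hx'.2]))

theorem legendreSonin_pi_div_two (c : ℕ) :
    legendreSonin c (Real.pi / 2) = legendreEnergy c := by
  simp [legendreSonin, legendreEnergy, legendrePotential, angularLegendre, angularLegendreDeriv]

theorem legendreEnergy_le_legendreSonin (c : ℕ) {t : ℝ} (ht0 : 0 < t) (ht1 : t < Real.pi) :
    legendreEnergy c ≤ legendreSonin c t := by
  rw [← legendreSonin_pi_div_two]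
  refine le_of_deriv_sign ht0 ht1 (hasDerivAt_legendreSonin c) (fun x hs hc => ?_)
    (fun x hs hc => ?_)
  · refine mul_nonpos_of_nonpos_of_nonneg (div_nonpos_of_nonpos_of_nonneg ?_ ?_) ?_
    · linarith
    · positivity
    · positivity
  · have : 0 ≤ -Real.cos x := by linarith
    positivity

theorem legendreSonin_div_potential_le (c : ℕ) {t : ℝ} (ht0 : 0 < t) (ht1 : t < Real.pi) :
    legendreSonin c t / legendrePotential c t ≤
      legendreEnergy c / legendrePotential c (Real.pi / 2) := by
  rw [← legendreSonin_pi_div_two]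
  refine neg_le_neg_iff.1 (le_of_deriv_sign (f := fun t => -(legendreSonin c t /
    legendrePotential c t)) (f' := fun t => -(Real.cos t / (2 * Real.sin t ^ 3) * (Real.sin t *
    (angularLegendreDeriv c t + Real.cos t / (2 * Real.sin t) * angularLegendre c t) ^ 2) /
    legendrePotential c t ^ 2)) ht0 ht1 (fun x hs => ?_) (fun x hs hc => ?_) (fun x hs hc => ?_))
  · refine ((hasDerivAt_legendreSonin c x hs).div (hasDerivAt_legendrePotential c x hs)
      (legendrePotential_pos c x).ne').neg.congr_deriv ?_
    rw [legendreSonin]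
    ring
  · exact neg_nonpos.2 (by positivity)
  · refine neg_nonneg.2 (div_nonpos_of_nonpos_of_nonneg (mul_nonpos_of_nonpos_of_nonneg
      (div_nonpos_of_nonpos_of_nonneg hc ?_) ?_) ?_) <;> positivity

/-! ### Location of the zeros -/

/-- Sturm comparison of `√(sin t) P_c(-cos t)` with `sin ((c + 1/2) t)`. -/
theorem exists_angularLegendre_eq_zero (c : ℕ) {a b : ℝ} (ha : 0 < a) (hb : b < Real.pi)
    (hab : b = a + Real.pi / ((c : ℝ) + 1 / 2)) :
    ∃ t ∈ Set.Ioo a b, angularLegendre c t = 0 := by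
  have hN : (0 : ℝ) < (c : ℝ) + 1 / 2 := by positivity
  set N : ℝ := (c : ℝ) + 1 / 2 with hNdef
  have hpi := Real.pi_pos
  have hlt : a < b := by rw [hab]; linarith [div_pos hpi hN]
  have hsin : ∀ x ∈ Set.Icc a b, 0 < Real.sin x := fun x hx =>
    Real.sin_pos_of_pos_of_lt_pi (by linarith [hx.1]) (by linarith [hx.2])
  have hcont : Continuous (angularLegendre c) :=
    continuous_iff_continuousAt.2 fun t => (hasDerivAt_angularLegendre c t).continuousAt
  by_contra! hne
  -- Without zeros the sign is constant; multiplying by the midpoint value σ normalises it to be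
  -- positive.
  obtain ⟨σ, hσ⟩ : ∃ σ : ℝ, ∀ t ∈ Set.Ioo a b, 0 < σ * angularLegendre c t := by
    have hm : (a + b) / 2 ∈ Set.Ioo a b := ⟨by linarith, by linarith⟩
    refine ⟨angularLegendre c ((a + b) / 2), fun t ht => ?_⟩
    by_contra! hneg
    have hconn := isPreconnected_Ioo.image (s := Set.Ioo a b) _ hcont.continuousOn
    have h0 : (0 : ℝ) ∈ angularLegendre c '' Set.Ioo a b := by
      rcases (hne _ hm).lt_or_gt with h | h
      · exact hconn.Icc_subset ⟨_, hm, rfl⟩ ⟨t, ht, rfl⟩ ⟨h.le, by nlinarith⟩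
      · exact hconn.Icc_subset ⟨t, ht, rfl⟩ ⟨_, hm, rfl⟩ ⟨by nlinarith, h.le⟩
    obtain ⟨z, hz, hz0⟩ := h0
    exact hne z hz hz0
  have hσ' : ∀ t ∈ Set.Icc a b, 0 ≤ σ * angularLegendre c t := by
    intro t ht
    rw [← closure_Ioo hlt.ne] at ht
    exact closure_minimal (fun x hx => (hσ x hx).le)
      (isClosed_le continuous_const (hcont.const_mul σ)) ht
  -- The Wronskian u'v - uv' with v = sin(N(x - a)), scaled by σ. Its derivative is (N² - φ)uv,
  -- negative inside the interval, yet the Wronskian is -Nu(a) ≤ 0 at a and Nu(b) ≥ 0 at b.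
  have hderiv : ∀ x ∈ Set.Icc a b, HasDerivAt (fun x => σ * (Real.sqrt (Real.sin x) *
      ((angularLegendreDeriv c x + Real.cos x / (2 * Real.sin x) * angularLegendre c x) *
        Real.sin (N * (x - a)) - N * Real.cos (N * (x - a)) * angularLegendre c x)))
      (-(1 / (4 * Real.sin x ^ 2) * Real.sqrt (Real.sin x) * (σ * angularLegendre c x) *
        Real.sin (N * (x - a)))) x := by
    intro x hx
    have hs0 := hsin x hx
    have hs := Real.hasDerivAt_sin x
    have hc := Real.hasDerivAt_cos x
    have hy := hasDerivAt_angularLegendre c x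
    have hd := hasDerivAt_angularLegendreDeriv c x hs0
    have hl : HasDerivAt (fun x => N * (x - a)) N x := by
      simpa using ((hasDerivAt_id x).sub_const a).const_mul N
    have h := ((hs.sqrt hs0.ne').mul (((hd.add ((hc.div (hs.const_mul 2) (by positivity)).mul
      hy)).mul hl.sin).sub ((hl.cos.const_mul N).mul hy))).const_mul σ
    refine h.congr_deriv ?_
    have hcs : Real.cos x ^ 2 = 1 - Real.sin x ^ 2 := Real.cos_sq' x
    have hcN : (c : ℝ) = N - 1 / 2 := by rw [hNdef]; ring
    have hr : Real.sqrt (Real.sin x) ^ 2 = Real.sin x := Real.sq_sqrt hs0.le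
    have hr0 : 0 < Real.sqrt (Real.sin x) := Real.sqrt_pos.2 hs0
    simp only [Pi.mul_apply, Pi.add_apply, Pi.div_apply, Pi.sub_apply]
    rw [hcN]
    clear_value N
    generalize Real.sqrt (Real.sin x) = r at *
    generalize angularLegendre c x = y at *
    generalize angularLegendreDeriv c x = d at *
    generalize Real.cos x = a at *
    generalize Real.sin (N * _) = S at *
    generalize Real.cos (N * _) = C at *
    rw [← hr] at hcs ⊢
    field_simp
    linear_combination (-(4 * σ * y * S)) * hcs
  have hanti := strictAntiOn_of_deriv_neg (convex_Icc a b)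
    (fun x hx => (hderiv x hx).continuousAt.continuousWithinAt) (fun x hx => by
      rw [(hderiv x (interior_subset hx)).deriv]
      rw [interior_Icc] at hx
      have h1 := hσ x hx
      have h2 := hsin x (Set.Ioo_subset_Icc_self hx)
      have h3 : 0 < Real.sin (N * (x - a)) := by
        refine Real.sin_pos_of_pos_of_lt_pi (mul_pos hN (by linarith [hx.1])) ?_
        have h4 : x - a < Real.pi / N := by linarith [hx.2]
        rw [lt_div_iff₀ hN] at h4
        linarith
      have h5 := Real.sqrt_pos.2 h2
      exact neg_neg_of_pos (by positivity)) (Set.left_mem_Icc.2 hlt.le) (Set.right_mem_Icc.2 hlt.le)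
      hlt
  have hNb : N * (b - a) = Real.pi := by rw [hab]; field_simp; ring
  simp only [sub_self, mul_zero, Real.sin_zero, Real.cos_zero, hNb, Real.sin_pi,
    Real.cos_pi] at hanti
  have h1 := hσ' a (Set.left_mem_Icc.2 hlt.le)
  have h2 := hσ' b (Set.right_mem_Icc.2 hlt.le)
  have h3 : 0 ≤ N * Real.sqrt (Real.sin a) * (σ * angularLegendre c a) := by positivity
  have h4 : 0 ≤ N * Real.sqrt (Real.sin b) * (σ * angularLegendre c b) := by positivity
  linarith

theorem exists_legendreNode_eq_neg_cos (c : ℕ) (i : Fin c) :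
    ∃ t : ℝ, Real.pi * ((i : ℝ) + 1 / 4) < t * ((c : ℝ) + 1 / 2) ∧
      t * ((c : ℝ) + 1 / 2) < Real.pi * ((i : ℝ) + 5 / 4) ∧
      legendreNode c i = -Real.cos t ∧ angularLegendre c t = 0 := by
  have hpi := Real.pi_pos
  have hN : (0 : ℝ) < (c : ℝ) + 1 / 2 := by positivity
  -- The c adjacent windows of length π/(c + 1/2) leave a total slack of half a window in (0, π);
  -- the offset 1/4 centres them.
  have hex : ∀ i : Fin c, ∃ t ∈ Set.Ioo (Real.pi * ((i : ℝ) + 1 / 4) / ((c : ℝ) + 1 / 2))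
      (Real.pi * ((i : ℝ) + 5 / 4) / ((c : ℝ) + 1 / 2)), angularLegendre c t = 0 := by
    intro i
    have hi : (i : ℝ) + 1 ≤ c := by exact_mod_cast i.2
    refine exists_angularLegendre_eq_zero c (by positivity) ?_ ?_
    · rw [div_lt_iff₀ hN]
      exact mul_lt_mul_of_pos_left (by linarith) hpi
    · field_simp
      ring
  choose t ht hzero using hex
  have hlt : ∀ i j : Fin c, i < j → t i < t j := by
    intro i j hij
    have hij' : (i : ℝ) + 1 ≤ j := by exact_mod_cast hij
    refine (ht i).2.trans_le (le_trans ?_ (ht j).1.le)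
    gcongr ?_ / _
    exact mul_le_mul_of_nonneg_left (by linarith) hpi.le
  have hmem : ∀ i : Fin c, t i ∈ Set.Icc 0 Real.pi := by
    intro i
    have hi : (i : ℝ) + 1 ≤ c := by exact_mod_cast i.2
    refine ⟨le_trans (by positivity) (ht i).1.le, (ht i).2.le.trans ?_⟩
    rw [div_le_iff₀ hN]
    exact mul_le_mul_of_nonneg_left (by linarith) hpi.le
  have hne : legendreP c ≠ 0 := by
    rintro h
    have := legendreP_card_roots c
    rw [h] at this
    simp only [roots_zero, Multiset.toFinset_zero, Finset.card_empty] at this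
    exact (this ▸ i).elim0
  -- One zero per window gives c increasing roots, which must be the full ordered list.
  have huniq := Finset.orderEmbOfFin_unique (legendreP_card_roots c)
    (f := fun i => -Real.cos (t i))
    (fun i => by
      rw [Multiset.mem_toFinset, mem_roots hne]
      exact hzero i)
    (fun i j hij => neg_lt_neg (Real.strictAntiOn_cos (hmem i) (hmem j) (hlt i j hij)))
  refine ⟨t i, ?_, ?_, ?_, hzero i⟩
  · exact (div_lt_iff₀ hN).1 (ht i).1
  · exact (lt_div_iff₀ hN).1 (ht i).2
  · exact (congrFun huniq i).symm

/-! ### Two-sided bounds for the weights -/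

theorem two_div_legendreSonin_of_zero (c : ℕ) {t : ℝ} (ht : 0 < Real.sin t)
    (h0 : angularLegendre c t = 0) :
    2 / legendreSonin c t = 2 / ((1 - (-Real.cos t) ^ 2) ^ (3 / 2 : ℝ) *
      ((derivative (legendreP c)).eval (-Real.cos t)) ^ 2) := by
  have h : (1 - (-Real.cos t) ^ 2) ^ (3 / 2 : ℝ) = Real.sin t ^ 3 := by
    rw [neg_sq, ← Real.sin_sq, ← Real.rpow_natCast, ← Real.rpow_natCast, ← Real.rpow_mul ht.le]
    norm_num
  rw [h, legendreSonin, h0, angularLegendreDeriv]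
  congr 1
  ring

theorem glWeight_lt (c : ℕ) (i : Fin c) : glWeight c i < Real.pi / c := by
  obtain ⟨t, h1, h2, h3, h0⟩ := exists_legendreNode_eq_neg_cos c i
  have hpi := Real.pi_pos
  have hN : (0 : ℝ) < (c : ℝ) + 1 / 2 := by positivity
  have hi : (i : ℝ) + 1 ≤ c := by exact_mod_cast i.2
  have hi0 : (0 : ℝ) ≤ i := by positivity
  have ht0 : 0 < t := pos_of_mul_pos_left (lt_trans (by positivity) h1) hN.le
  have ht1 : t < Real.pi := lt_of_mul_lt_mul_right
    (h2.trans_le (mul_le_mul_of_nonneg_left (by linarith) hpi.le)) hN.le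
  have hE := lt_legendreEnergy c
  have hS := legendreEnergy_le_legendreSonin c ht0 ht1
  have hc : (0 : ℝ) < c := by linarith
  have hEpos : 0 < legendreEnergy c := pos_of_mul_pos_left (lt_trans (by positivity) hE) hpi.le
  rw [glWeight, h3, ← two_div_legendreSonin_of_zero c (Real.sin_pos_of_pos_of_lt_pi ht0 ht1) h0,
    div_lt_div_iff₀ (by linarith) hc]
  nlinarith

/-- With q the sum of the two inverse squares, φ(t) ≤ φ(π/2)(1 + q) forces S ≤ E(1 + q), and 1/(1 +
q) ≥ 1 - q. The bound is uniform in i, so it can be summed over all nodes. -/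
theorem le_glWeight (c : ℕ) (i : Fin c) :
    Real.pi / ((c : ℝ) + 3 / 2) * (1 - (1 / ((i : ℝ) + 1) ^ 2 + 1 / ((c : ℝ) - i) ^ 2)) ≤
      glWeight c i := by
  obtain ⟨t, h1, h2, h3, h0⟩ := exists_legendreNode_eq_neg_cos c i
  have hpi := Real.pi_pos
  have hN : (0 : ℝ) < (c : ℝ) + 1 / 2 := by positivity
  have hi : (i : ℝ) + 1 ≤ c := by exact_mod_cast i.2
  have hi0 : (0 : ℝ) ≤ i := by positivity
  have ht0 : 0 < t := pos_of_mul_pos_left (lt_trans (by positivity) h1) hN.le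
  have ht1 : t < Real.pi := lt_of_mul_lt_mul_right
    (h2.trans_le (mul_le_mul_of_nonneg_left (by linarith) hpi.le)) hN.le
  have hs := Real.sin_pos_of_pos_of_lt_pi ht0 ht1
  have hc : (0 : ℝ) < c := by linarith
  have hci : (0 : ℝ) < (c : ℝ) - i := by linarith
  set q : ℝ := 1 / ((i : ℝ) + 1) ^ 2 + 1 / ((c : ℝ) - i) ^ 2 with hq
  have hq0 : 0 < q := by positivity
  have hE := lt_legendreEnergy c
  have hE' := legendreEnergy_le c
  have hEpos : 0 < legendreEnergy c := pos_of_mul_pos_left (lt_trans (by positivity) hE) hpi.le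
  have hS := legendreEnergy_le_legendreSonin c ht0 ht1
  have hSq := legendreSonin_div_potential_le c ht0 ht1
  -- Jordan's inequality sin t ≥ 2t/π, applied to t or to π - t, combined with the window containing
  -- t.
  have key : 1 / (4 * Real.sin t ^ 2) ≤ ((c : ℝ) + 1 / 2) ^ 2 * q := by
    rcases le_total t (Real.pi / 2) with h | h
    · have h4 := Real.mul_le_sin ht0.le h
      rw [div_mul_eq_mul_div, div_le_iff₀ hpi] at h4
      have h5 : (i : ℝ) + 1 ≤ 2 * ((c : ℝ) + 1 / 2) * Real.sin t := by
        refine le_of_mul_le_mul_left ?_ hpi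
        nlinarith [mul_le_mul_of_nonneg_right h4 hN.le]
      have h6 : ((c : ℝ) + 1 / 2) ^ 2 * (1 / ((i : ℝ) + 1) ^ 2) ≤ ((c : ℝ) + 1 / 2) ^ 2 * q := by
        rw [hq]; gcongr; linarith [show 0 < 1 / ((c : ℝ) - i) ^ 2 by positivity]
      refine le_trans ?_ h6
      rw [mul_one_div, div_le_div_iff₀ (by positivity) (by positivity)]
      nlinarith [pow_le_pow_left₀ (by linarith) h5 2]
    · have h4 := Real.mul_le_sin (sub_nonneg.2 ht1.le) (by linarith : Real.pi - t ≤ Real.pi / 2)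
      rw [div_mul_eq_mul_div, div_le_iff₀ hpi, Real.sin_pi_sub] at h4
      have h5 : (c : ℝ) - i ≤ 2 * ((c : ℝ) + 1 / 2) * Real.sin t := by
        refine le_of_mul_le_mul_left ?_ hpi
        nlinarith [mul_le_mul_of_nonneg_right h4 hN.le]
      have h6 : ((c : ℝ) + 1 / 2) ^ 2 * (1 / ((c : ℝ) - i) ^ 2) ≤ ((c : ℝ) + 1 / 2) ^ 2 * q := by
        rw [hq]; gcongr; linarith [show 0 < 1 / ((i : ℝ) + 1) ^ 2 by positivity]
      refine le_trans ?_ h6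
      rw [mul_one_div, div_le_div_iff₀ (by positivity) (by positivity)]
      nlinarith [pow_le_pow_left₀ hci.le h5 2]
  have hphi : legendrePotential c t ≤ legendrePotential c (Real.pi / 2) * (1 + q) := by
    simp only [legendrePotential, Real.sin_pi_div_two]
    nlinarith
  have hSle : legendreSonin c t ≤ legendreEnergy c * (1 + q) := by
    rw [div_le_div_iff₀ (legendrePotential_pos c t) (legendrePotential_pos c _)] at hSq
    refine le_of_mul_le_mul_right ?_ (legendrePotential_pos c (Real.pi / 2))
    nlinarith [mul_le_mul_of_nonneg_left hphi hEpos.le]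
  rw [glWeight, h3, ← two_div_legendreSonin_of_zero c hs h0, div_mul_eq_mul_div,
    div_le_div_iff₀ (by positivity) (by linarith)]
  rcases le_total 1 q with hq1 | hq1
  · have : Real.pi * (1 - q) * legendreSonin c t ≤ 0 :=
      mul_nonpos_of_nonpos_of_nonneg (mul_nonpos_of_nonneg_of_nonpos hpi.le (by linarith))
        (by linarith)
    linarith
  · have h7 : 0 ≤ Real.pi * (1 - q) := mul_nonneg hpi.le (by linarith)
    calc Real.pi * (1 - q) * legendreSonin c t
        ≤ Real.pi * (1 - q) * (legendreEnergy c * (1 + q)) := by gcongr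
      _ = legendreEnergy c * Real.pi * (1 - q ^ 2) := by ring
      _ ≤ legendreEnergy c * Real.pi := mul_le_of_le_one_right (by positivity) (by nlinarith)
      _ ≤ 2 * ((c : ℝ) + 3 / 2) := by linarith

/-! ### Asymptotics of the points -/

theorem abs_sin_sq_sub_sin_sq_le (a b : ℝ) : |Real.sin a ^ 2 - Real.sin b ^ 2| ≤ |a - b| := by
  have h : Real.sin a ^ 2 - Real.sin b ^ 2 = Real.sin (a + b) * Real.sin (a - b) := by
    rw [Real.sin_add, Real.sin_sub]
    linear_combination (Real.sin b ^ 2) * Real.sin_sq_add_cos_sq a -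
      (Real.sin a ^ 2) * Real.sin_sq_add_cos_sq b
  rw [h, abs_mul]
  calc |Real.sin (a + b)| * |Real.sin (a - b)| ≤ 1 * |a - b| :=
        mul_le_mul (Real.abs_sin_le_one _) (Real.abs_sin_le_abs) (abs_nonneg _) zero_le_one
    _ = |a - b| := one_mul _

/-- Here p = sin²(t/2), sin² is 1-Lipschitz, and tc differs from π(i + 1) by at most 2π. No
restriction to the bulk is needed. -/
theorem abs_glPoint_sub_le (c : ℕ) (i : Fin c) :
    |glPoint c i - Real.sin (Real.pi * ((i : ℝ) + 1) / (2 * (c : ℝ))) ^ 2| ≤ Real.pi / c := by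
  obtain ⟨t, h1, h2, h3, -⟩ := exists_legendreNode_eq_neg_cos c i
  have hpi := Real.pi_pos
  have hi : (i : ℝ) + 1 ≤ c := by exact_mod_cast i.2
  have hi0 : (0 : ℝ) ≤ i := by positivity
  have hc : (0 : ℝ) < c := by linarith
  have hN : (0 : ℝ) < (c : ℝ) + 1 / 2 := by positivity
  have hp : glPoint c i = Real.sin (t / 2) ^ 2 := by
    rw [glPoint, h3, Real.sin_sq_eq_half_sub, mul_div_cancel₀ t two_ne_zero]
    ring
  rw [hp]
  refine (abs_sin_sq_sub_sin_sq_le _ _).trans ?_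
  have hup : t * c ≤ Real.pi * ((i : ℝ) + 3) := by
    have ht0 : 0 < t := pos_of_mul_pos_left (lt_trans (by positivity) h1) hN.le
    nlinarith
  have hlow : Real.pi * ((i : ℝ) - 1) ≤ t * c := by
    refine le_of_mul_le_mul_right ?_ hN
    have h4 := mul_le_mul_of_nonneg_right h1.le hc.le
    have h5 : ((i : ℝ) - 1) * ((c : ℝ) + 1 / 2) ≤ ((i : ℝ) + 1 / 4) * c := by nlinarith
    nlinarith [mul_le_mul_of_nonneg_left h5 hpi.le]
  have he : t / 2 - Real.pi * ((i : ℝ) + 1) / (2 * c) =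
      (t * c - Real.pi * ((i : ℝ) + 1)) / 2 / c := by
    field_simp
  rw [he, abs_div, abs_of_pos hc]
  gcongr
  rw [abs_le]
  constructor <;> linarith

/-! ### Summation and limits -/

theorem sum_range_inv_succ_sq_le (n : ℕ) :
    ∑ i ∈ Finset.range n, 1 / ((i : ℝ) + 1) ^ 2 ≤ 2 := by
  -- Telescoping, because (n + 1/2)(n + 3/2) < (n + 1)².
  suffices h : ∑ i ∈ Finset.range n, 1 / ((i : ℝ) + 1) ^ 2 ≤ 2 - 1 / ((n : ℝ) + 1 / 2) from
    h.trans (sub_le_self _ (by positivity))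
  induction n with
  | zero => norm_num
  | succ n ih =>
    rw [Finset.sum_range_succ]
    have h : 1 / ((n : ℝ) + 1) ^ 2 ≤ 1 / ((n : ℝ) + 1 / 2) - 1 / (((n + 1 : ℕ) : ℝ) + 1 / 2) := by
      rw [div_sub_div _ _ (by positivity) (by positivity),
        div_le_div_iff₀ (by positivity) (by positivity)]
      push_cast
      nlinarith
    linarith

theorem glNorm_lt_pi (c : ℕ) (hc : 1 ≤ c) : glNorm c < Real.pi := by
  have hc0 : (c : ℝ) ≠ 0 := by positivity
  calc glNorm c < ∑ _i : Fin c, Real.pi / c :=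
        Finset.sum_lt_sum_of_nonempty ⟨⟨0, hc⟩, Finset.mem_univ _⟩ fun i _ => glWeight_lt c i
    _ = Real.pi := by
        rw [Finset.sum_const, Finset.card_univ, Fintype.card_fin, nsmul_eq_mul]
        field_simp

theorem le_glNorm (c : ℕ) : Real.pi / ((c : ℝ) + 3 / 2) * (c - 4) ≤ glNorm c := by
  refine le_trans ?_ (Finset.sum_le_sum fun i _ => le_glWeight c i)
  rw [← Finset.mul_sum, Finset.sum_sub_distrib, Finset.sum_add_distrib]
  have h1 : ∑ i : Fin c, 1 / ((i : ℝ) + 1) ^ 2 ≤ 2 := by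
    rw [Fin.sum_univ_eq_sum_range fun i => 1 / ((i : ℝ) + 1) ^ 2]
    exact sum_range_inv_succ_sq_le c
  have h2 : ∑ i : Fin c, 1 / ((c : ℝ) - i) ^ 2 ≤ 2 := by
    refine le_trans (le_of_eq ?_) h1
    refine Fintype.sum_equiv Fin.revPerm _ _ fun i => ?_
    have : ((Fin.revPerm i : Fin c) : ℝ) + 1 = (c : ℝ) - i := by
      have := i.2
      rw [Fin.revPerm_apply, Fin.val_rev, Nat.cast_sub (by omega)]
      push_cast
      ring
    rw [this]
  have h3 : ∑ _i : Fin c, (1 : ℝ) = c := by simp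
  rw [h3]
  have := Real.pi_pos
  gcongr
  linarith

theorem tendsto_glNorm : Tendsto glNorm atTop (𝓝 Real.pi) := by
  have h1 : Tendsto (fun c : ℕ => (c : ℝ) / (c + 3 / 2)) atTop (𝓝 1) :=
    tendsto_natCast_div_add_atTop _
  have h2 : Tendsto (fun c : ℕ => (4 : ℝ) / c) atTop (𝓝 0) := tendsto_const_div_atTop_nhds_zero_nat 4
  have h3 := (h1.const_mul Real.pi).mul (h2.const_sub 1)
  rw [mul_one, sub_zero, mul_one] at h3
  refine tendsto_of_tendsto_of_tendsto_of_le_of_le' h3 tendsto_const_nhds ?_ ?_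
  · filter_upwards [eventually_ge_atTop 1] with c hc
    refine le_trans (le_of_eq ?_) (le_glNorm c)
    have : (c : ℝ) ≠ 0 := by positivity
    field_simp
  · filter_upwards [eventually_ge_atTop 1] with c hc
    exact (glNorm_lt_pi c hc).le

theorem eventually_abs_glWeight_sub_le {α ε : ℝ} (hα : 0 < α) (hε : 0 < ε) :
    ∀ᶠ c : ℕ in atTop, ∀ i : Fin c, α * (c : ℝ) < (i : ℝ) + 1 →
      (i : ℝ) + 1 < (1 - α) * (c : ℝ) → |glWeight c i - Real.pi / (c : ℝ)| ≤ ε / (c : ℝ) := by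
  have h1 : Tendsto (fun c : ℕ => (c : ℝ) / (c + 3 / 2)) atTop (𝓝 1) :=
    tendsto_natCast_div_add_atTop _
  have h2 : Tendsto (fun c : ℕ => 1 / α / (c : ℝ)) atTop (𝓝 0) :=
    tendsto_const_div_atTop_nhds_zero_nat _
  have h3 := (h1.const_mul Real.pi).mul (((h2.pow 2).const_mul 2).const_sub 1)
  norm_num only [mul_one, sub_zero] at h3
  filter_upwards [h3.eventually_const_lt (sub_lt_self Real.pi hε), eventually_ge_atTop 1]
    with c hlow hc i hi1 hi2
  have hc0 : (0 : ℝ) < c := by positivity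
  have hpi := Real.pi_pos
  have hup := (glWeight_lt c i).le
  have hw := le_glWeight c i
  -- In the bulk both i + 1 and c - i exceed αc, so the relative error is O(1/c²) uniformly in i.
  have hq : 1 / ((i : ℝ) + 1) ^ 2 + 1 / ((c : ℝ) - i) ^ 2 ≤ 2 * (1 / α / (c : ℝ)) ^ 2 := by
    have e : (1 / α / (c : ℝ)) ^ 2 = 1 / (α * c) ^ 2 := by rw [div_div, div_pow, one_pow]
    rw [e, two_mul]
    gcongr
    linarith
  have hw' : Real.pi - ε ≤ glWeight c i * c := by
    refine hlow.le.trans ?_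
    calc _ = Real.pi / ((c : ℝ) + 3 / 2) * (1 - 2 * (1 / α / (c : ℝ)) ^ 2) * c := by ring
      _ ≤ Real.pi / ((c : ℝ) + 3 / 2) *
          (1 - (1 / ((i : ℝ) + 1) ^ 2 + 1 / ((c : ℝ) - i) ^ 2)) * c := by gcongr
      _ ≤ _ := by gcongr
  rw [abs_le]
  constructor
  · have := (div_le_iff₀ hc0).2 hw'
    rw [sub_div] at this
    linarith
  · have : 0 < ε / c := by positivity
    linarith

theorem theorem1 :
    (∀ α : ℝ, 0 < α → ∀ ε : ℝ, 0 < ε → ∀ᶠ c : ℕ in atTop, ∀ i : Fin c,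
      α * (c : ℝ) < (i : ℝ) + 1 → (i : ℝ) + 1 < (1 - α) * (c : ℝ) →
        |glPoint c i - Real.sin (Real.pi * ((i : ℝ) + 1) / (2 * (c : ℝ))) ^ 2| ≤ ε ∧
        |glWeight c i - Real.pi / (c : ℝ)| ≤ ε / (c : ℝ)) ∧
    Tendsto glNorm atTop (𝓝 Real.pi) ∧
    (∀ c : ℕ, 1 ≤ c → glNorm c < Real.pi) := by
  refine ⟨fun α hα ε hε => ?_, tendsto_glNorm, glNorm_lt_pi⟩
  have h : ∀ᶠ c : ℕ in atTop, Real.pi / c < ε :=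
    (tendsto_const_div_atTop_nhds_zero_nat Real.pi).eventually_lt_const hε
  filter_upwards [h, eventually_abs_glWeight_sub_le hα hε] with c h1 h2 i hi1 hi2
  exact ⟨(abs_glPoint_sub_le c i).trans h1.le, h2 i hi1 hi2⟩
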